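/- Let $(X_n)_{n\ge 0}$ be a time-homogeneous Markov chain on a probability space $(\Omega,\mathcal F,\mathbb P)$ with countable (finite or countably infinite) state space $S$ and transition matrix $P=(P_{ij})_{i,j\in S}$, and let $\mu^{(0)}_i=\mathbb P(X_0=i)$ be its initial distribution; the chain is not assumed irreducible. For $i\in S$ let $\mathbb P_i$ denote the law of the Markov chain with transition matrix $P$ started at $i$, with expectation $\mathbb E_i$. For $i,j\in S$ put $$f_{ij}=\mathbb P_i(\exists\, n\ge 1: X_n=j),\qquad T_j=\inf\{n\ge 1: X_n=j\}\in\{1,2,\dots\}\cup\{\infty\},\qquad m_j=\mathbb E_j[T_j].$$ A state $j$ is positive recurrent if $f_{jj}=1$ and $m_j<\infty$; let $C\subseteq S$ be the set of positive recurrent states. If $g:S\to\mathbb R$ satisfies $\sum_{i\in S}|g(i)|<\infty$, then every $g(X_k)$ is integrable, the series on the right-hand side below converge absolutely, and $$\lim_{n\to\infty}\frac1n\sum_{k=1}^n\mathbb E\, g(X_k)=\sum_{j\in C}\frac{g(j)}{m_j}\sum_{i\in S}\mu^{(0)}_i f_{ij}.$$ -/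

import Mathlib

open MeasureTheory ProbabilityTheory Filter Topology
open scoped ENNReal

namespace CountableChain

noncomputable section

variable {S : Type*} [MeasurableSpace S]

/-- A stochastic matrix on `S` is given by its rows `P i : PMF S`; its `(i, j)` entry is `P i j`.
`X` is a (time-homogeneous) Markov chain with transition matrix `P` on the probability space
`(Ω, μ)`: the elementary Markov property
`μ (X (n+1) = j | X 0 = x 0, …, X n = x n) = P (x n) j`
holds whenever the conditioning event has positive probability. -/
structure IsMarkovChain {Ω : Type*} [MeasurableSpace Ω] (P : S → PMF S) (X : ℕ → Ω → S)
    (μ : Measure Ω) : Prop where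
  measurable : ∀ n, Measurable (X n)
  markov : ∀ (n : ℕ) (x : ℕ → S) (j : S), μ {ω | ∀ k ≤ n, X k ω = x k} ≠ 0 →
    ProbabilityTheory.cond μ {ω | ∀ k ≤ n, X k ω = x k} {ω | X (n + 1) ω = j} = P (x n) j

variable [Countable S] [MeasurableSingletonClass S]

/-- The one-step transition kernel `i ↦ P i` on the countable discrete space `S`. -/
def stepKernel (P : S → PMF S) : Kernel S S where
  toFun i := (P i).toMeasure
  measurable' := measurable_of_countable _

instance isMarkovKernel_stepKernel (P : S → PMF S) : IsMarkovKernel (stepKernel P) :=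
  ⟨fun i => PMF.toMeasure.isProbabilityMeasure (P i)⟩

/-- The transition kernel from the history up to time `n` to the state at time `n + 1`; it depends
on the history through the state at time `n` only. -/
def historyKernel (P : S → PMF S) (n : ℕ) : Kernel ((k : Finset.Iic n) → (fun _ : ℕ => S) k) S :=
  (stepKernel P).comap (fun x => x ⟨n, Finset.mem_Iic.2 le_rfl⟩) (measurable_pi_apply _)

instance isMarkovKernel_historyKernel (P : S → PMF S) (n : ℕ) :
    IsMarkovKernel (historyKernel P n) :=
  Kernel.IsMarkovKernel.comap _ _

/-- The law, on the space `ℕ → S` of trajectories, of the Markov chain with transition matrix `P`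
started at `i`, that is, `Pr( · | X 0 = i)`. -/
def chainLaw (P : S → PMF S) (i : S) : Measure (ℕ → S) :=
  Kernel.traj (X := fun _ : ℕ => S) (historyKernel P) 0 (fun _ => i)

/-- `f i j = Pr(∃ n ≥ 1, X n = j | X 0 = i)`. -/
def hitProb (P : S → PMF S) (i j : S) : ℝ :=
  (chainLaw P i).real {x | ∃ n : ℕ, 1 ≤ n ∧ x n = j}

/-- The first time `n ≥ 1` at which the trajectory `x` is at `j` (infinite if there is none). -/
def returnTime (j : S) (x : ℕ → S) : ℝ≥0∞ :=
  ⨅ (n : ℕ) (_ : 1 ≤ n ∧ x n = j), (n : ℝ≥0∞)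

/-- The mean recurrence time `m j`: expected return time to `j` of the chain started at `j`. -/
def meanReturnTime (P : S → PMF S) (j : S) : ℝ≥0∞ :=
  ∫⁻ x, returnTime j x ∂(chainLaw P j)

/-- `j` is recurrent: the chain started at `j` almost surely returns to `j`. -/
def IsRecurrent (P : S → PMF S) (j : S) : Prop :=
  hitProb P j j = 1

/-- `j` is positive recurrent: it is recurrent and its mean recurrence time is finite. -/
def IsPositiveRecurrent (P : S → PMF S) (j : S) : Prop :=
  IsRecurrent P j ∧ meanReturnTime P j < ∞

end

end CountableChain

/-! Fix a state `j`. Under the law started at `j`, the visit probabilities `u k` form a renewal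
sequence whose waiting time is the return time `T`, with survival function `r k = Pr(T > k)` and `∑
k, r k = m j`. Splitting by the last visit gives `∑ k ≤ n, r k * u (n - k) = 1`. Summed over `n`,
and combined with monotonicity and the Lipschitz bound for partial sums of `u`, this yields Cesàro
averages tending to `1 / m j`, which is `0` if the mean is infinite (`tendsto_average_renewal`).

For an arbitrary initial law, restarting at the first visit writes `Pr(X (n+1) = j)` as the
convolution of the first-visit law with `u`. The limit is then multiplied by the probability of ever
visiting `j` (`tendsto_average_convolution`), which is the mixture of the `f i j` over the initial
state.

Finally the expected averages are `∑ j, g j * A n j` with `0 ≤ A n j ≤ 1`, so dominated convergence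
with bound `|g j|` exchanges limit and sum. States that are not positive recurrent have infinite
mean and drop out. -/

namespace CountableChain

/-! ### Elementary renewal theory -/

section Renewal

/-- The `k`-th term is the probability that the last renewal up to time `n` occurs at `n - k`. In
the induction, the mass lost through `f` is exactly `u (n + 1)` by the renewal equation, and the new
term `k = 0` restores it. -/
theorem sum_survival_mul_renewal {u f r : ℕ → ℝ} (hu0 : u 0 = 1) (hr0 : r 0 = 1)
    (hr : ∀ k, r (k + 1) = r k - f k)
    (hren : ∀ n, u (n + 1) = ∑ k ∈ Finset.range (n + 1), f k * u (n - k)) (n : ℕ) :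
    ∑ k ∈ Finset.range (n + 1), r k * u (n - k) = 1 := by
  induction n with
  | zero => simp [hu0, hr0]
  | succ n ih =>
    rw [Finset.sum_range_succ']
    have h : ∀ k ∈ Finset.range (n + 1), r (k + 1) * u (n + 1 - (k + 1)) =
        r k * u (n - k) - f k * u (n - k) := by
      intro k _
      rw [hr, Nat.add_sub_add_right]
      ring
    rw [Finset.sum_congr rfl h, Finset.sum_sub_distrib, ih, ← hren, hr0]
    simp

theorem sum_survival_mul_sum_renewal {u r : ℕ → ℝ}
    (h : ∀ n, ∑ k ∈ Finset.range (n + 1), r k * u (n - k) = 1) (n : ℕ) :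
    ∑ k ∈ Finset.range n, r k * ∑ l ∈ Finset.range (n - k), u l = n := by
  induction n with
  | zero => simp
  | succ n ih =>
    have h' : ∀ k ∈ Finset.range (n + 1), r k * ∑ l ∈ Finset.range (n + 1 - k), u l =
        r k * ∑ l ∈ Finset.range (n - k), u l + r k * u (n - k) := by
      intro k hk
      have : n + 1 - k = n - k + 1 := by
        have := Finset.mem_range.1 hk
        omega
      rw [this, Finset.sum_range_succ]
      ring
    rw [Finset.sum_congr rfl h', Finset.sum_add_distrib, h, Finset.sum_range_succ, ih]
    simp

/-- The elementary renewal theorem: the Cesàro averages of a renewal sequence converge to the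
inverse of the (possibly infinite) mean `∑ k, r k` of the waiting time, where `r` is the survival
function of the waiting time. -/
theorem tendsto_average_renewal {u f r : ℕ → ℝ} (hu0 : u 0 = 1) (hr0 : r 0 = 1)
    (hu : ∀ k, 0 ≤ u k) (hu1 : ∀ k, u k ≤ 1) (hrn : ∀ k, 0 ≤ r k)
    (hr : ∀ k, r (k + 1) = r k - f k)
    (hren : ∀ n, u (n + 1) = ∑ k ∈ Finset.range (n + 1), f k * u (n - k)) :
    Tendsto (fun n : ℕ => (∑ k ∈ Finset.range n, u k) / n) atTop
      (𝓝 ((∑' k, ENNReal.ofReal (r k))⁻¹).toReal) := by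
  set V : ℕ → ℝ := fun n => ∑ k ∈ Finset.range n, u k with hV
  set R : ℕ → ℝ := fun n => ∑ k ∈ Finset.range n, r k with hR
  have hVR : ∀ n, ∑ k ∈ Finset.range n, r k * V (n - k) = n :=
    sum_survival_mul_sum_renewal (sum_survival_mul_renewal hu0 hr0 hr hren)
  have hVmono : Monotone V := fun a b hab =>
    Finset.sum_le_sum_of_subset_of_nonneg (Finset.range_mono hab) fun i _ _ => hu i
  -- Since `u ≤ 1`, dropping `k` terms lowers the partial sum by at most `k`.
  have hVsub : ∀ n k, k ≤ n → V n - k ≤ V (n - k) := by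
    intro n k hk
    have h : V n = V (n - k) + ∑ l ∈ Finset.range k, u (n - k + l) := by
      simp only [hV]
      rw [← Finset.sum_range_add, Nat.sub_add_cancel hk]
    have h2 : ∑ l ∈ Finset.range k, u (n - k + l) ≤ k := by
      simpa using Finset.sum_le_card_nsmul (Finset.range k) (fun l => u (n - k + l)) 1
        fun l _ => hu1 _
    linarith
  have hR1 : ∀ n, 1 ≤ R (n + 1) := by
    intro n
    simp only [hR]
    rw [Finset.sum_range_succ', hr0]
    have : 0 ≤ ∑ k ∈ Finset.range n, r (k + 1) := Finset.sum_nonneg fun k _ => hrn _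
    linarith
  have hlim : Tendsto (fun n => (R (n + 1))⁻¹) atTop
      (𝓝 ((∑' k, ENNReal.ofReal (r k))⁻¹).toReal) := by
    have h1 : Tendsto (fun n => (∑ k ∈ Finset.range (n + 1), ENNReal.ofReal (r k))⁻¹) atTop
        (𝓝 (∑' k, ENNReal.ofReal (r k))⁻¹) :=
      ((tendsto_inv _).comp ((tendsto_add_atTop_iff_nat 1).2
        (ENNReal.summable.hasSum.tendsto_sum_nat)))
    have hne : (∑' k, ENNReal.ofReal (r k))⁻¹ ≠ ∞ := by
      rw [ENNReal.inv_ne_top]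
      intro h0
      have := ENNReal.tsum_eq_zero.1 h0 0
      simp [hr0] at this
    refine ((ENNReal.tendsto_toReal hne).comp h1).congr fun n => ?_
    simp only [Function.comp, hR]
    rw [ENNReal.toReal_inv, ← ENNReal.ofReal_sum_of_nonneg fun k _ => hrn k,
      ENNReal.toReal_ofReal (Finset.sum_nonneg fun k _ => hrn k)]
  -- In the identity `hVR`, each `V (n + 1 - k)` is replaced by the larger `V (n + 1)`.
  have hlow : ∀ n : ℕ, (R (n + 1))⁻¹ ≤ V (n + 1) / ((n + 1 : ℕ) : ℝ) := by
    intro n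
    have h0 : 0 < R (n + 1) := lt_of_lt_of_le one_pos (hR1 n)
    have h1 : ((n + 1 : ℕ) : ℝ) ≤ V (n + 1) * R (n + 1) := by
      rw [← hVR, hR, mul_comm, Finset.sum_mul]
      exact Finset.sum_le_sum fun k _ =>
        mul_le_mul_of_nonneg_left (hVmono (Nat.sub_le _ _)) (hrn k)
    rw [inv_le_iff_one_le_mul₀ h0, div_mul_eq_mul_div, one_le_div (by positivity)]
    exact h1
  -- Conversely, only the first `K + 1` terms of `hVR` are kept, and there `V (n - k) ≥ V n - (K +
  -- 1)`; `K` stays fixed while `n` grows.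
  have hupp : ∀ K n : ℕ, K + 1 ≤ n → V n / n ≤ (R (K + 1))⁻¹ + (K + 1 : ℕ) / (n : ℝ) := by
    intro K n hn
    have h0 : 0 < R (K + 1) := lt_of_lt_of_le one_pos (hR1 K)
    have hn0 : (0 : ℝ) < n := by
      have : 0 < n := by omega
      exact_mod_cast this
    have hV0 : ∀ m, 0 ≤ V m := fun m => Finset.sum_nonneg fun k _ => hu k
    have h1 : (V n - (K + 1 : ℕ)) * R (K + 1) ≤ n := by
      rw [← hVR n, hR, mul_comm, Finset.sum_mul]
      refine le_trans (Finset.sum_le_sum fun k hk => ?_)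
        (Finset.sum_le_sum_of_subset_of_nonneg (Finset.range_mono hn)
          fun k _ _ => mul_nonneg (hrn k) (hV0 _))
      have hk' := Finset.mem_range.1 hk
      refine mul_le_mul_of_nonneg_left (le_trans ?_ (hVsub n k (by omega))) (hrn k)
      have : (k : ℝ) ≤ ((K + 1 : ℕ) : ℝ) := by exact_mod_cast hk'.le
      linarith
    rw [← sub_le_iff_le_add, ← sub_div, div_le_iff₀ hn0, inv_mul_eq_div, le_div_iff₀ h0]
    exact h1
  refine (tendsto_add_atTop_iff_nat 1).1 (tendsto_order.2 ⟨fun a ha => ?_, fun a ha => ?_⟩)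
  · filter_upwards [hlim.eventually_const_lt ha] with n hn
    exact hn.trans_le (hlow n)
  · obtain ⟨K, hK⟩ := (hlim.eventually_lt_const ha).exists
    have h2 : Tendsto (fun n : ℕ => (R (K + 1))⁻¹ + ((K + 1 : ℕ) : ℝ) / ((n + 1 : ℕ) : ℝ)) atTop
        (𝓝 ((R (K + 1))⁻¹ + 0)) :=
      tendsto_const_nhds.add ((tendsto_add_atTop_iff_nat 1).2
        (tendsto_const_div_atTop_nhds_zero_nat _))
    rw [add_zero] at h2
    filter_upwards [h2.eventually_lt_const hK, eventually_ge_atTop K] with n hn hn'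
    exact (hupp K (n + 1) (by omega)).trans_lt hn

/-- Cesàro averages of a convolution of a summable sequence with a bounded sequence. -/
theorem tendsto_average_convolution {a F u : ℕ → ℝ} {L : ℝ} (hu : ∀ k, 0 ≤ u k)
    (hu1 : ∀ k, u k ≤ 1) (hF : ∀ k, 0 ≤ F k) (hFs : Summable F)
    (ha : ∀ n, a (n + 1) = ∑ k ∈ Finset.range (n + 1), F k * u (n - k))
    (hL : Tendsto (fun n : ℕ => (∑ k ∈ Finset.range n, u k) / n) atTop (𝓝 L)) :
    Tendsto (fun n : ℕ => (1 / (n : ℝ)) * ∑ k ∈ Finset.Icc 1 n, a k) atTop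
      (𝓝 ((∑' k, F k) * L)) := by
  set V : ℕ → ℝ := fun n => ∑ k ∈ Finset.range n, u k with hV
  have hV0 : ∀ m, 0 ≤ V m := fun m => Finset.sum_nonneg fun k _ => hu k
  have hV1 : ∀ m : ℕ, V m ≤ m := fun m => by
    simpa using Finset.sum_le_card_nsmul (Finset.range m) u 1 fun l _ => hu1 _
  have hsum : ∀ n, ∑ k ∈ Finset.Icc 1 n, a k = ∑ k ∈ Finset.range n, F k * V (n - k) := by
    intro n
    induction n with
    | zero => simp
    | succ n ih =>
      rw [Finset.sum_Icc_succ_top (by omega), ih, ha, Finset.sum_range_succ _ n,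
        Finset.sum_range_succ _ n, ← add_assoc, ← Finset.sum_add_distrib]
      have h1 : V (n + 1 - n) = u (n - n) := by simp [hV]
      rw [h1]
      congr 1
      refine Finset.sum_congr rfl fun k hk => ?_
      have : n + 1 - k = n - k + 1 := by
        have := Finset.mem_range.1 hk
        omega
      rw [this, ← mul_add]
      simp only [hV, Finset.sum_range_succ]
  -- Truncated subtraction makes the terms with `k ≥ n` vanish, so the finite sum is a series to
  -- which dominated convergence applies.
  have hsum' : ∀ n : ℕ, (1 / (n : ℝ)) * ∑ k ∈ Finset.Icc 1 n, a k =
      ∑' k, F k * (V (n - k) / n) := by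
    intro n
    rw [hsum, tsum_eq_sum (s := Finset.range n), Finset.mul_sum]
    · exact Finset.sum_congr rfl fun k _ => by ring
    · intro k hk
      have : n - k = 0 := by
        have := Finset.mem_range.not.1 hk
        omega
      simp [this, hV]
  simp_rw [hsum']
  rw [← tsum_mul_right]
  refine tendsto_tsum_of_dominated_convergence hFs (fun k => ?_) (Eventually.of_forall fun n k => ?_)
  · refine Tendsto.const_mul _ ?_
    have h1 : Tendsto (fun n : ℕ => V (n + k - k) / n * ((n : ℝ) / ((n + k : ℕ) : ℝ))) atTop
        (𝓝 (L * 1)) := by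
      simp only [Nat.add_sub_cancel]
      refine hL.mul ?_
      have := tendsto_natCast_div_add_atTop (𝕜 := ℝ) (k : ℝ)
      simpa using this
    rw [mul_one] at h1
    refine (tendsto_add_atTop_iff_nat k).1 (h1.congr' ?_)
    filter_upwards [eventually_gt_atTop 0] with n hn
    have : (n : ℝ) ≠ 0 := by exact_mod_cast hn.ne'
    field_simp
  · rw [Real.norm_eq_abs, abs_of_nonneg (mul_nonneg (hF k) (div_nonneg (hV0 _) (by positivity)))]
    refine mul_le_of_le_one_right (hF k) (div_le_one_of_le₀ ((hV1 _).trans ?_) (by positivity))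
    exact_mod_cast Nat.sub_le n k

end Renewal

/-! ### Markov property on events of the past -/

theorem measure_eq_tsum_fiber {Ω T : Type*} [MeasurableSpace Ω] [Countable T] [MeasurableSpace T]
    [MeasurableSingletonClass T] (μ : Measure Ω) {h : Ω → T} (hh : Measurable h) (A : Set Ω) :
    μ A = ∑' t, μ {ω | ω ∈ A ∧ h ω = t} := by
  have hm : ∀ t, MeasurableSet (h ⁻¹' {t}) := fun t => hh (measurableSet_singleton t)
  -- Restricting to `A` and evaluating on the whole space requires no measurability of `A`, so
  -- history events need none either.
  have := tsum_measure_preimage_singleton (μ := μ.restrict A) (Set.countable_univ (α := T)) (f := h)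
    fun t _ => hm t
  rw [Set.preimage_univ, Measure.restrict_apply_univ,
    tsum_univ fun t => (μ.restrict A) (h ⁻¹' {t})] at this
  rw [← this]
  refine tsum_congr fun t => ?_
  rw [Measure.restrict_apply (hm t)]
  congr 1
  ext ω
  simp [and_comm]

variable {S : Type*}

/-- The event `A` depends on the values of the process `X` up to time `n` only. -/
def DependsOnHistory {Ω : Type*} (X : ℕ → Ω → S) (n : ℕ) (A : Set Ω) : Prop :=
  ∀ ω ω', (∀ k ≤ n, X k ω = X k ω') → ω ∈ A → ω' ∈ A

theorem DependsOnHistory.inter_eq {Ω : Type*} {X : ℕ → Ω → S} {n : ℕ} {A : Set Ω}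
    (hA : DependsOnHistory X n A) (m : ℕ) (l : S) :
    DependsOnHistory X (n + m) {ω | ω ∈ A ∧ X (n + m) ω = l} := fun ω ω' h hω =>
  ⟨hA ω ω' (fun k hk => h k (by omega)) hω.1, (h _ le_rfl).symm.trans hω.2⟩

variable [MeasurableSpace S]

theorem IsMarkovChain.measure_path {Ω : Type*} [MeasurableSpace Ω] [MeasurableSingletonClass S]
    {μ : Measure Ω} [IsProbabilityMeasure μ] {P : S → PMF S} {X : ℕ → Ω → S}
    (hX : IsMarkovChain P X μ) (n : ℕ) (x : ℕ → S) (j : S) :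
    μ {ω | (∀ k ≤ n, X k ω = x k) ∧ X (n + 1) ω = j} =
      μ {ω | ∀ k ≤ n, X k ω = x k} * P (x n) j := by
  have hm : MeasurableSet {ω | ∀ k ≤ n, X k ω = x k} := by
    simp only [Set.ofPred_forall]
    exact MeasurableSet.iInter fun k => MeasurableSet.iInter fun _ =>
      hX.measurable k (measurableSet_singleton (x k))
  by_cases h0 : μ {ω | ∀ k ≤ n, X k ω = x k} = 0
  · rw [h0, zero_mul]
    exact measure_mono_null (fun ω hω => hω.1) h0
  · rw [← hX.markov n x j h0, mul_comm, cond_mul_eq_inter hm]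
    rfl

variable [Countable S] [MeasurableSingletonClass S]

section Markov

variable {Ω : Type*} [MeasurableSpace Ω] {μ : Measure Ω} [IsProbabilityMeasure μ] {P : S → PMF S}
  {X : ℕ → Ω → S}

/-- The one-step Markov property on an event depending on the history. -/
theorem IsMarkovChain.measure_succ (hX : IsMarkovChain P X μ) {n : ℕ} {A : Set Ω}
    (hA : DependsOnHistory X n A) (l j : S) :
    μ {ω | (ω ∈ A ∧ X n ω = l) ∧ X (n + 1) ω = j} = μ {ω | ω ∈ A ∧ X n ω = l} * P l j := by
  have hh : Measurable fun ω (k : Finset.Iic n) => X k ω :=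
    measurable_pi_lambda _ fun k => hX.measurable k
  rw [measure_eq_tsum_fiber μ hh, measure_eq_tsum_fiber μ hh {ω | ω ∈ A ∧ X n ω = l},
    ← ENNReal.tsum_mul_right]
  refine tsum_congr fun y => ?_
  -- The values of `x` beyond time `n` play no role; `l` is a filler.
  let x : ℕ → S := fun k => if hk : k ≤ n then y ⟨k, Finset.mem_Iic.2 hk⟩ else l
  have hxy : ∀ ω, ((fun k : Finset.Iic n => X k ω) = y) ↔ ∀ k ≤ n, X k ω = x k := by
    intro ω
    refine ⟨fun h k hk => ?_, fun h => funext fun k => ?_⟩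
    · simp only [x, dif_pos hk, ← h]
    · have hk := Finset.mem_Iic.1 k.2
      have := h k hk
      simpa only [x, dif_pos hk] using this
  simp only [hxy]
  -- As `A` is determined by the history, each history fibre lies inside `A ∩ {X n = l}` or is
  -- disjoint from it.
  by_cases hex : ∃ ω, (ω ∈ A ∧ X n ω = l) ∧ ∀ k ≤ n, X k ω = x k
  · obtain ⟨ω₀, ⟨hω₀, hl⟩, hω₀x⟩ := hex
    have hxl : x n = l := (hω₀x n le_rfl).symm.trans hl
    have h1 : ∀ ω, (∀ k ≤ n, X k ω = x k) → ω ∈ A ∧ X n ω = l := fun ω hω =>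
      ⟨hA ω₀ ω (fun k hk => (hω₀x k hk).trans (hω k hk).symm) hω₀, (hω n le_rfl).trans hxl⟩
    have h2 := hX.measure_path n x j
    rw [hxl] at h2
    convert h2 using 2
    · congr 1
      ext ω
      exact ⟨fun h => ⟨h.2, h.1.2⟩, fun h => ⟨⟨h1 ω h.1, h.2⟩, h.1⟩⟩
    · congr 1
      ext ω
      exact ⟨fun h => h.2, fun h => ⟨h1 ω h, h⟩⟩
  · have h1 : {ω | ω ∈ {ω | (ω ∈ A ∧ X n ω = l) ∧ X (n + 1) ω = j} ∧ ∀ k ≤ n, X k ω = x k} = ∅ :=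
      Set.eq_empty_of_forall_notMem fun ω hω => hex ⟨ω, hω.1.1, hω.2⟩
    have h2 : {ω | ω ∈ {ω | ω ∈ A ∧ X n ω = l} ∧ ∀ k ≤ n, X k ω = x k} = ∅ :=
      Set.eq_empty_of_forall_notMem fun ω hω => hex ⟨ω, hω.1, hω.2⟩
    rw [h1, h2]
    simp

theorem IsMarkovChain.measure_succ_eq_tsum (hX : IsMarkovChain P X μ) {n : ℕ} {A : Set Ω}
    (hA : DependsOnHistory X n A) (j : S) :
    μ {ω | ω ∈ A ∧ X (n + 1) ω = j} = ∑' l, μ {ω | ω ∈ A ∧ X n ω = l} * P l j := by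
  rw [measure_eq_tsum_fiber μ (hX.measurable n)]
  refine tsum_congr fun l => ?_
  rw [← hX.measure_succ hA]
  congr 1
  ext ω
  exact and_right_comm

end Markov

/-! ### The canonical chain started at a point -/

section ChainLaw

variable (P : S → PMF S) (i : S)

instance isProbabilityMeasure_chainLaw : IsProbabilityMeasure (chainLaw P i) :=
  inferInstanceAs (IsProbabilityMeasure (Kernel.traj (X := fun _ : ℕ => S) _ 0 _))

/-- The joint law of the history and the next state is the composition-product of the history law
with `historyKernel`; evaluating it on a singleton rectangle gives the elementary Markov property.
-/
theorem isMarkovChain_chainLaw : IsMarkovChain P (fun n (x : ℕ → S) => x n) (chainLaw P i) := by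
  refine ⟨fun n => measurable_pi_apply n, fun n x j h0 => ?_⟩
  have hm : MeasurableSet {ω : ℕ → S | ∀ k ≤ n, ω k = x k} := by
    simp only [Set.ofPred_forall]
    exact MeasurableSet.iInter fun k => MeasurableSet.iInter fun _ =>
      (measurable_pi_apply (X := fun _ : ℕ => S) k) (measurableSet_singleton (x k))
  let y : (k : Finset.Iic n) → S := fun k => x k
  have hy : ∀ ω : ℕ → S, Preorder.frestrictLe (π := fun _ => S) n ω = y ↔ ∀ k ≤ n, ω k = x k := by
    intro ω
    refine ⟨fun h k hk => congrFun h ⟨k, Finset.mem_Iic.2 hk⟩, fun h => funext fun k => ?_⟩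
    exact h k (Finset.mem_Iic.1 k.2)
  have key := congrArg (fun ν : Measure _ => ν ({y} ×ˢ {j}))
    (Kernel.partialTraj_compProd_eq_map_traj (X := fun _ : ℕ => S) (κ := historyKernel P)
      (Nat.zero_le n) (x₀ := fun _ => i))
  have hyj : MeasurableSet (({y} : Set ((k : Finset.Iic n) → S)) ×ˢ ({j} : Set S)) :=
    (measurableSet_singleton y).prod (measurableSet_singleton j)
  beta_reduce at key
  rw [Measure.compProd_apply_prod (measurableSet_singleton y) (measurableSet_singleton j),
    Measure.map_apply (by fun_prop) hyj, Measure.restrict_singleton, lintegral_smul_measure,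
    lintegral_dirac, ← Kernel.traj_map_frestrictLe_apply,
    Measure.map_apply (by fun_prop) (measurableSet_singleton y)] at key
  have e1 : historyKernel P n y {j} = P (x n) j :=
    PMF.toMeasure_apply_singleton (P (x n)) j (measurableSet_singleton j)
  have e2 : Preorder.frestrictLe (π := fun _ => S) n ⁻¹' {y} = {ω : ℕ → S | ∀ k ≤ n, ω k = x k} := by
    ext ω
    exact hy ω
  have e3 : (fun ω : ℕ → S => (Preorder.frestrictLe (π := fun _ => S) n ω, ω (n + 1))) ⁻¹'
      ({y} ×ˢ {j}) = {ω : ℕ → S | ∀ k ≤ n, ω k = x k} ∩ {ω | ω (n + 1) = j} := by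
    ext ω
    exact and_congr (hy ω) Iff.rfl
  rw [e1, e2, e3] at key
  rw [cond_apply hm]
  change _ = P (x n) j
  rw [show chainLaw P i _ = _ from key.symm, smul_eq_mul, ← mul_assoc]
  rw [show Kernel.traj (X := fun _ : ℕ => S) (historyKernel P) 0 (fun _ => i) = chainLaw P i from rfl,
    ENNReal.inv_mul_cancel h0 (measure_ne_top _ _), one_mul]

open scoped Classical in
theorem chainLaw_zero (j : S) : chainLaw P i {x | x 0 = j} = if i = j then 1 else 0 := by
  have key := Kernel.traj_map_frestrictLe_apply (X := fun _ : ℕ => S) (κ := historyKernel P) 0 0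
    (fun _ => i)
  rw [Kernel.partialTraj_self, Kernel.id_apply] at key
  have h := congrArg (fun ν : Measure _ => ν {fun _ => j}) key
  beta_reduce at h
  rw [Measure.map_apply (by fun_prop) (measurableSet_singleton _),
    Measure.dirac_apply' _ (measurableSet_singleton _)] at h
  have e : Preorder.frestrictLe (π := fun _ => S) 0 ⁻¹' {fun _ => j} = {x : ℕ → S | x 0 = j} := by
    ext x
    refine ⟨fun h => congrFun h ⟨0, Finset.mem_Iic.2 le_rfl⟩, fun h => funext fun k => ?_⟩
    have hk : (k : ℕ) = 0 := Nat.le_zero.1 (Finset.mem_Iic.1 k.2)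
    change x k = j
    rw [hk]
    exact h
  rw [e] at h
  refine h.trans ?_
  by_cases hij : i = j
  · simp [hij]
  · rw [if_neg hij, Set.indicator_of_notMem]
    exact fun h => hij (congrFun h ⟨0, Finset.mem_Iic.2 le_rfl⟩)

end ChainLaw

section Decomposition

variable {Ω : Type*} [MeasurableSpace Ω] {μ : Measure Ω} [IsProbabilityMeasure μ] {P : S → PMF S}
  {X : ℕ → Ω → S}

/-- The Markov property: the chain restarts afresh from its state at a fixed time. -/
theorem IsMarkovChain.measure_add (hX : IsMarkovChain P X μ) {n : ℕ} {A : Set Ω}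
    (hA : DependsOnHistory X n A) (i : S) (m : ℕ) (j : S) :
    μ {ω | (ω ∈ A ∧ X n ω = i) ∧ X (n + m) ω = j} =
      μ {ω | ω ∈ A ∧ X n ω = i} * chainLaw P i {x | x m = j} := by
  have hA' : DependsOnHistory X n {ω | ω ∈ A ∧ X n ω = i} := hA.inter_eq 0 i
  induction m generalizing j with
  | zero =>
    rw [chainLaw_zero]
    split_ifs with hij
    · rw [mul_one]
      congr 1
      ext ω
      exact ⟨fun h => h.1, fun h => ⟨h, h.2.trans hij⟩⟩
    · rw [mul_zero]
      refine measure_mono_null (fun ω h => ?_) (measure_empty (μ := μ))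
      exact hij (h.1.2.symm.trans h.2)
  | succ m ih =>
    have h1 : DependsOnHistory X (n + m) {ω | ω ∈ A ∧ X n ω = i} := fun ω ω' h =>
      hA' ω ω' fun k hk => h k (by omega)
    have h2 := hX.measure_succ_eq_tsum h1 j
    have h3 := (isMarkovChain_chainLaw P i).measure_succ_eq_tsum (n := m) (A := Set.univ)
      (fun _ _ _ _ => trivial) j
    simp only [Set.mem_univ, true_and] at h3
    rw [h3, ← ENNReal.tsum_mul_left]
    refine h2.trans (tsum_congr fun l => ?_)
    rw [← mul_assoc, ← ih]
    rfl

end Decomposition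

/-! ### First visits and return times -/

section FirstVisit

variable {S Ω : Type*} {X : ℕ → Ω → S}

/-- The event that `X` does not visit `j` at the times `1, …, n`. -/
def avoids (X : ℕ → Ω → S) (j : S) (n : ℕ) : Set Ω :=
  {ω | ∀ m, 1 ≤ m → m ≤ n → X m ω ≠ j}

/-- The event that the first visit to `j` at a positive time takes place at time `n + 1`. -/
def firstVisit (X : ℕ → Ω → S) (j : S) (n : ℕ) : Set Ω :=
  {ω | ω ∈ avoids X j n ∧ X (n + 1) ω = j}

theorem avoids_zero (j : S) : avoids X j 0 = Set.univ :=
  Set.eq_univ_of_forall fun _ m h1 h2 => absurd (h1.trans h2) (by decide)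

theorem mem_avoids_succ {j : S} {n : ℕ} {ω : Ω} :
    ω ∈ avoids X j (n + 1) ↔ ω ∈ avoids X j n ∧ X (n + 1) ω ≠ j := by
  refine ⟨fun h => ⟨fun m h1 h2 => h m h1 (by omega), h _ (by omega) le_rfl⟩, fun h m h1 h2 => ?_⟩
  rcases Nat.le_succ_iff.1 h2 with h3 | h3
  · exact h.1 m h1 h3
  · rw [h3]
    exact h.2

theorem dependsOnHistory_avoids (X : ℕ → Ω → S) (j : S) (n : ℕ) :
    DependsOnHistory X n (avoids X j n) := fun ω ω' h hω m h1 h2 => by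
  rw [← h m h2]
  exact hω m h1 h2

theorem pairwise_disjoint_firstVisit (X : ℕ → Ω → S) (j : S) :
    Pairwise (Function.onFun Disjoint (firstVisit X j)) := by
  have key : ∀ a b, a < b → Disjoint (firstVisit X j a) (firstVisit X j b) := fun a b hab =>
    Set.disjoint_left.2 fun ω ha hb => hb.1 (a + 1) (by omega) hab ha.2
  intro a b hab
  rcases lt_or_gt_of_ne hab with h | h
  · exact key a b h
  · exact (key b a h).symm

theorem exists_mem_firstVisit {j : S} {n : ℕ} {ω : Ω} (h : X (n + 1) ω = j) :
    ∃ k ≤ n, ω ∈ firstVisit X j k := by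
  classical
  have hex : ∃ k, X (k + 1) ω = j := ⟨n, h⟩
  refine ⟨Nat.find hex, Nat.find_min' hex h, fun m h1 h2 => ?_, Nat.find_spec hex⟩
  obtain ⟨m, rfl⟩ := Nat.exists_eq_add_of_le' h1
  exact Nat.find_min hex (Nat.lt_of_succ_le h2)

theorem iUnion_firstVisit (X : ℕ → Ω → S) (j : S) :
    ⋃ n, firstVisit X j n = {ω | ∃ n, 1 ≤ n ∧ X n ω = j} := by
  ext ω
  refine ⟨fun h => ?_, fun ⟨n, h1, h2⟩ => ?_⟩
  · obtain ⟨n, hn⟩ := Set.mem_iUnion.1 h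
    exact ⟨n + 1, by omega, hn.2⟩
  · obtain ⟨n, rfl⟩ := Nat.exists_eq_add_of_le' h1
    obtain ⟨k, -, hk⟩ := exists_mem_firstVisit h2
    exact Set.mem_iUnion.2 ⟨k, hk⟩

variable [MeasurableSpace S] [MeasurableSingletonClass S] [MeasurableSpace Ω]

theorem measurableSet_avoids (hX : ∀ n, Measurable (X n)) (j : S) (n : ℕ) :
    MeasurableSet (avoids X j n) := by
  simp only [avoids, Set.ofPred_forall]
  exact MeasurableSet.iInter fun m => MeasurableSet.iInter fun _ => MeasurableSet.iInter fun _ =>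
    (hX m (measurableSet_singleton j)).compl

theorem measurableSet_firstVisit (hX : ∀ n, Measurable (X n)) (j : S) (n : ℕ) :
    MeasurableSet (firstVisit X j n) :=
  (measurableSet_avoids hX j n).inter (hX (n + 1) (measurableSet_singleton j))

theorem measure_exists_visit (μ : Measure Ω) (hX : ∀ n, Measurable (X n)) (j : S) :
    μ {ω | ∃ n, 1 ≤ n ∧ X n ω = j} = ∑' n, μ (firstVisit X j n) := by
  rw [← iUnion_firstVisit, measure_iUnion (pairwise_disjoint_firstVisit X j)
    (measurableSet_firstVisit hX j)]

theorem measureReal_avoids_succ (μ : Measure Ω) [IsFiniteMeasure μ] (hX : ∀ n, Measurable (X n))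
    (j : S) (n : ℕ) :
    μ.real (avoids X j (n + 1)) = μ.real (avoids X j n) - μ.real (firstVisit X j n) := by
  have h : avoids X j (n + 1) = avoids X j n \ firstVisit X j n := by
    ext ω
    rw [mem_avoids_succ]
    exact ⟨fun h => ⟨h.1, fun h' => h.2 h'.2⟩, fun h => ⟨h.1, fun h' => h.2 ⟨h.1, h'⟩⟩⟩
  rw [h, measureReal_sdiff (fun ω h => h.1) (measurableSet_firstVisit hX j n)]

end FirstVisit

/-- This is `T = ∑ n, 1_{T > n}`, valid also when `T = ∞`. -/
theorem returnTime_eq_tsum {S : Type*} (j : S) (x : ℕ → S) : returnTime j x =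
    ∑' n, (avoids (fun n (x : ℕ → S) => x n) j n).indicator (fun _ => (1 : ℝ≥0∞)) x := by
  classical
  by_cases hex : ∃ n, 1 ≤ n ∧ x n = j
  · have hN := Nat.find_spec hex
    have hmem : ∀ n, x ∈ avoids (fun n (x : ℕ → S) => x n) j n ↔ n < Nat.find hex := by
      intro n
      refine ⟨fun h => not_le.1 fun hle => h _ hN.1 hle hN.2, fun h m h1 h2 h3 => ?_⟩
      exact Nat.find_min hex (h2.trans_lt h) ⟨h1, h3⟩
    rw [tsum_eq_sum (s := Finset.range (Nat.find hex)) fun n hn => by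
      rw [Set.indicator_of_notMem]
      rwa [hmem, ← Finset.mem_range]]
    rw [Finset.sum_congr rfl fun n hn => Set.indicator_of_mem
      ((hmem n).2 (Finset.mem_range.1 hn)) _]
    simp only [Finset.sum_const, Finset.card_range, nsmul_eq_mul, mul_one]
    refine le_antisymm (iInf₂_le (Nat.find hex) hN) (le_iInf₂ fun n hn => ?_)
    exact_mod_cast Nat.find_min' hex hn
  · have hmem : ∀ n, x ∈ avoids (fun n (x : ℕ → S) => x n) j n :=
      fun n m h1 _ h3 => hex ⟨m, h1, h3⟩
    simp only [Set.indicator_of_mem (hmem _)]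
    rw [ENNReal.tsum_const_eq_top_of_ne_zero one_ne_zero]
    exact iInf₂_eq_top.2 fun n hn => absurd ⟨n, hn⟩ hex

/-! ### First-visit decomposition and mean return times -/

variable {S : Type*} [MeasurableSpace S] [Countable S] [MeasurableSingletonClass S]
  {Ω : Type*} [MeasurableSpace Ω] {μ : Measure Ω} [IsProbabilityMeasure μ] {P : S → PMF S}
  {X : ℕ → Ω → S}

/-- Decomposition of a visit to `j` according to the time of the first visit. -/
theorem IsMarkovChain.measure_eq_sum_firstVisit (hX : IsMarkovChain P X μ) (j : S) (n : ℕ) :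
    μ {ω | X (n + 1) ω = j} =
      ∑ k ∈ Finset.range (n + 1), μ (firstVisit X j k) * chainLaw P j {x | x (n - k) = j} := by
  have h1 : {ω | X (n + 1) ω = j} =
      ⋃ k ∈ Finset.range (n + 1), {ω | ω ∈ firstVisit X j k ∧ X (n + 1) ω = j} := by
    ext ω
    simp only [Set.mem_iUnion, exists_prop]
    refine ⟨fun h => ?_, fun ⟨k, _, h⟩ => h.2⟩
    obtain ⟨k, hk, hω⟩ := exists_mem_firstVisit h
    exact ⟨k, Finset.mem_range.2 (by omega), hω, h⟩
  rw [h1, measure_biUnion_finset]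
  · refine Finset.sum_congr rfl fun k hk => ?_
    have hk' := Finset.mem_range.1 hk
    -- The chain restarts at the visit time `k + 1`, so the avoidance event is viewed as part of the
    -- history up to then.
    have hA : DependsOnHistory X (k + 1) (avoids X j k) := fun ω ω' h =>
      dependsOnHistory_avoids X j k ω ω' fun m hm => h m (by omega)
    have h2 := hX.measure_add hA j (n - k) j
    have h3 : k + 1 + (n - k) = n + 1 := by omega
    rw [h3] at h2
    exact h2
  · exact fun a _ b _ hab => (pairwise_disjoint_firstVisit X j hab).mono (fun ω h => h.1)
      fun ω h => h.1
  · exact fun k _ => (measurableSet_firstVisit hX.measurable j k).inter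
      (hX.measurable (n + 1) (measurableSet_singleton j))

theorem IsMarkovChain.measureReal_eq_sum_firstVisit (hX : IsMarkovChain P X μ) (j : S) (n : ℕ) :
    μ.real {ω | X (n + 1) ω = j} = ∑ k ∈ Finset.range (n + 1),
      μ.real (firstVisit X j k) * (chainLaw P j).real {x | x (n - k) = j} := by
  rw [measureReal_def, hX.measure_eq_sum_firstVisit, ENNReal.toReal_sum
    fun k _ => ENNReal.mul_ne_top (measure_ne_top _ _) (measure_ne_top _ _)]
  simp only [ENNReal.toReal_mul]
  rfl

/-- Both sides satisfy the same one-step recursion in `n`, and they agree at time `0`, where the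
canonical chain is at its starting point. -/
theorem IsMarkovChain.measure_avoids_eq_tsum (hX : IsMarkovChain P X μ) (j : S) (n : ℕ) (l : S) :
    μ {ω | ω ∈ avoids X j n ∧ X n ω = l} = ∑' i, μ {ω | X 0 ω = i} *
      chainLaw P i {x | x ∈ avoids (fun n (x : ℕ → S) => x n) j n ∧ x n = l} := by
  induction n generalizing l with
  | zero =>
    simp only [avoids_zero, Set.mem_univ, true_and, chainLaw_zero]
    rw [tsum_eq_single l fun i hi => by rw [if_neg hi, mul_zero], if_pos rfl, mul_one]
  | succ n ih =>
    by_cases hl : l = j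
    · have h0 : {ω | ω ∈ avoids X j (n + 1) ∧ X (n + 1) ω = l} = ∅ :=
        Set.eq_empty_of_forall_notMem fun ω h => (mem_avoids_succ.1 h.1).2 (h.2.trans hl)
      have h0' : {x | x ∈ avoids (fun n (x : ℕ → S) => x n) j (n + 1) ∧ x (n + 1) = l} = ∅ :=
        Set.eq_empty_of_forall_notMem fun ω h => (mem_avoids_succ.1 h.1).2 (h.2.trans hl)
      rw [h0, h0']
      simp
    · have h1 : {ω | ω ∈ avoids X j (n + 1) ∧ X (n + 1) ω = l} =
          {ω | ω ∈ avoids X j n ∧ X (n + 1) ω = l} := by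
        ext ω
        exact ⟨fun h => ⟨(mem_avoids_succ.1 h.1).1, h.2⟩,
          fun h => ⟨mem_avoids_succ.2 ⟨h.1, fun h' => hl (h.2.symm.trans h')⟩, h.2⟩⟩
      have h2 : {x | x ∈ avoids (fun n (x : ℕ → S) => x n) j (n + 1) ∧ x (n + 1) = l} =
          {x | x ∈ avoids (fun n (x : ℕ → S) => x n) j n ∧ x (n + 1) = l} := by
        ext ω
        exact ⟨fun h => ⟨(mem_avoids_succ.1 h.1).1, h.2⟩,
          fun h => ⟨mem_avoids_succ.2 ⟨h.1, fun h' => hl (h.2.symm.trans h')⟩, h.2⟩⟩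
      rw [h1, h2, hX.measure_succ_eq_tsum (dependsOnHistory_avoids X j n)]
      simp_rw [fun i => (isMarkovChain_chainLaw P i).measure_succ_eq_tsum
        (dependsOnHistory_avoids _ j n) l, ih, ← ENNReal.tsum_mul_left, ← ENNReal.tsum_mul_right]
      rw [ENNReal.tsum_comm]
      simp_rw [mul_assoc]

theorem IsMarkovChain.measure_firstVisit_eq_tsum (hX : IsMarkovChain P X μ) (j : S) (n : ℕ) :
    μ (firstVisit X j n) = ∑' i, μ {ω | X 0 ω = i} *
      chainLaw P i (firstVisit (fun n (x : ℕ → S) => x n) j n) := by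
  simp only [firstVisit]
  rw [hX.measure_succ_eq_tsum (dependsOnHistory_avoids X j n)]
  simp_rw [fun i => (isMarkovChain_chainLaw P i).measure_succ_eq_tsum
    (dependsOnHistory_avoids _ j n) j, hX.measure_avoids_eq_tsum, ← ENNReal.tsum_mul_left,
    ← ENNReal.tsum_mul_right]
  rw [ENNReal.tsum_comm]
  simp_rw [mul_assoc]

theorem IsMarkovChain.measure_exists_visit_eq_tsum (hX : IsMarkovChain P X μ) (j : S) :
    μ {ω | ∃ n, 1 ≤ n ∧ X n ω = j} = ∑' i, μ {ω | X 0 ω = i} *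
      chainLaw P i {x | ∃ n : ℕ, 1 ≤ n ∧ x n = j} := by
  rw [measure_exists_visit μ hX.measurable]
  simp_rw [hX.measure_firstVisit_eq_tsum, fun i => measure_exists_visit (chainLaw P i)
    (isMarkovChain_chainLaw P i).measurable j, ← ENNReal.tsum_mul_left]
  exact ENNReal.tsum_comm

theorem IsMarkovChain.summable_mul_hitProb (hX : IsMarkovChain P X μ) (j : S) :
    Summable fun i => μ.real {ω | X 0 ω = i} * hitProb P i j := by
  have h := hX.measure_exists_visit_eq_tsum j
  have := ENNReal.summable_toReal (h ▸ measure_ne_top μ _)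
  simp only [ENNReal.toReal_mul] at this
  exact this

theorem IsMarkovChain.measureReal_exists_visit (hX : IsMarkovChain P X μ) (j : S) :
    μ.real {ω | ∃ n, 1 ≤ n ∧ X n ω = j} = ∑' i, μ.real {ω | X 0 ω = i} * hitProb P i j := by
  have h := hX.measure_exists_visit_eq_tsum j
  rw [measureReal_def, h, ENNReal.tsum_toReal_eq
    fun i => ENNReal.mul_ne_top (measure_ne_top _ _) (measure_ne_top _ _)]
  simp only [ENNReal.toReal_mul]
  rfl

theorem meanReturnTime_eq_tsum (P : S → PMF S) (j : S) : meanReturnTime P j =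
    ∑' n, chainLaw P j (avoids (fun n (x : ℕ → S) => x n) j n) := by
  have hm := fun n => measurableSet_avoids (isMarkovChain_chainLaw P j).measurable j n
  simp only [meanReturnTime, returnTime_eq_tsum]
  rw [lintegral_tsum fun n => (measurable_const.indicator (hm n)).aemeasurable]
  simp only [lintegral_indicator_const (hm _), one_mul]

/-- The tails `Pr(T > n)` have finite sum, so they tend to `0`, and the event of no return is
contained in each `{T > n}`. -/
theorem isRecurrent_of_meanReturnTime_ne_top {P : S → PMF S} {j : S}
    (h : meanReturnTime P j ≠ ∞) : IsRecurrent P j := by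
  have hm : MeasurableSet {x : ℕ → S | ∃ n : ℕ, 1 ≤ n ∧ x n = j} := by
    have := MeasurableSet.iUnion fun n =>
      measurableSet_firstVisit (isMarkovChain_chainLaw P j).measurable j n
    rwa [iUnion_firstVisit] at this
  have hlim : Tendsto (fun n => chainLaw P j (avoids (fun n (x : ℕ → S) => x n) j n)) atTop (𝓝 0) :=
    ENNReal.tendsto_atTop_zero_of_tsum_ne_top (by rwa [← meanReturnTime_eq_tsum])
  have h0 : chainLaw P j {x : ℕ → S | ∃ n : ℕ, 1 ≤ n ∧ x n = j}ᶜ = 0 := by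
    refine le_antisymm (ge_of_tendsto' hlim fun n => measure_mono fun x hx m h1 _ h3 => ?_) bot_le
    exact hx ⟨m, h1, h3⟩
  rw [IsRecurrent, hitProb, measureReal_def, (prob_compl_eq_zero_iff hm).1 h0, ENNReal.toReal_one]

theorem isPositiveRecurrent_iff {P : S → PMF S} {j : S} :
    IsPositiveRecurrent P j ↔ meanReturnTime P j ≠ ∞ :=
  ⟨fun h => h.2.ne, fun h => ⟨isRecurrent_of_meanReturnTime_ne_top h, lt_top_iff_ne_top.2 h⟩⟩

/-- The expected proportion of time the chain spends at `j`. -/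
theorem IsMarkovChain.tendsto_average_measureReal (hX : IsMarkovChain P X μ) (j : S) :
    Tendsto (fun n : ℕ => (1 / (n : ℝ)) * ∑ k ∈ Finset.Icc 1 n, μ.real {ω | X k ω = j}) atTop
      (𝓝 (((meanReturnTime P j).toReal)⁻¹ *
        ∑' i, μ.real {ω | X 0 ω = i} * hitProb P i j)) := by
  have hj := isMarkovChain_chainLaw P j
  have hL := tendsto_average_renewal (u := fun n => (chainLaw P j).real {x | x n = j})
    (f := fun n => (chainLaw P j).real (firstVisit (fun n (x : ℕ → S) => x n) j n))
    (r := fun n => (chainLaw P j).real (avoids (fun n (x : ℕ → S) => x n) j n))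
    (by simp [measureReal_def, chainLaw_zero]) (by simp [avoids_zero])
    (fun _ => measureReal_nonneg) (fun _ => measureReal_le_one) (fun _ => measureReal_nonneg)
    (fun n => measureReal_avoids_succ _ hj.measurable j n) (hj.measureReal_eq_sum_firstVisit j)
  simp only [fun s => ofReal_measureReal (measure_ne_top (chainLaw P j) s)] at hL
  rw [← meanReturnTime_eq_tsum, ENNReal.toReal_inv] at hL
  have hF := measure_exists_visit μ hX.measurable j
  have hFs : Summable fun n => μ.real (firstVisit X j n) :=
    ENNReal.summable_toReal (hF ▸ measure_ne_top μ _)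
  have := tendsto_average_convolution (a := fun n => μ.real {ω | X n ω = j})
    (fun _ => measureReal_nonneg) (fun _ => measureReal_le_one) (fun _ => measureReal_nonneg)
    hFs (hX.measureReal_eq_sum_firstVisit j) hL
  rwa [← hX.measureReal_exists_visit, mul_comm, measureReal_def, hF,
    ENNReal.tsum_toReal_eq fun n => measure_ne_top _ _]

end CountableChain

/-! ### Averages of expectations -/

open CountableChain in
theorem mainTheorem3 {S : Type*} [Countable S] [MeasurableSpace S] [MeasurableSingletonClass S]
    {Ω : Type*} [MeasurableSpace Ω] (μ : Measure Ω) [IsProbabilityMeasure μ]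
    (P : S → PMF S) (X : ℕ → Ω → S) (hX : CountableChain.IsMarkovChain P X μ)
    (g : S → ℝ) (hg : Summable (fun i => |g i|)) :
    (∀ k, Integrable (fun ω => g (X k ω)) μ) ∧
    (∀ j, Summable (fun i => μ.real {ω | X 0 ω = i} * CountableChain.hitProb P i j)) ∧
    Summable (fun j : {j : S // CountableChain.IsPositiveRecurrent P j} =>
      g j / (CountableChain.meanReturnTime P j).toReal *
        ∑' i, μ.real {ω | X 0 ω = i} * CountableChain.hitProb P i j) ∧
    Tendsto (fun n : ℕ => (1 / (n : ℝ)) * ∑ k ∈ Finset.Icc 1 n, ∫ ω, g (X k ω) ∂μ) atTop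
      (𝓝 (∑' j : {j : S // CountableChain.IsPositiveRecurrent P j},
        g j / (CountableChain.meanReturnTime P j).toReal *
          ∑' i, μ.real {ω | X 0 ω = i} * CountableChain.hitProb P i j)) := by
  have hgm : Measurable g := measurable_of_countable g
  have hint : ∀ k, Integrable (fun ω => g (X k ω)) μ := fun k =>
    Integrable.of_bound (hgm.comp (hX.measurable k)).aestronglyMeasurable (∑' i, |g i|)
      (Eventually.of_forall fun ω => hg.le_tsum (X k ω) fun i _ => abs_nonneg (g i))
  set A : ℕ → S → ℝ := fun n j => (1 / (n : ℝ)) * ∑ k ∈ Finset.Icc 1 n, μ.real {ω | X k ω = j}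
    with hA
  set L : S → ℝ := fun j => ((meanReturnTime P j).toReal)⁻¹ *
    ∑' i, μ.real {ω | X 0 ω = i} * hitProb P i j with hL
  have hlim : ∀ j, Tendsto (fun n => A n j) atTop (𝓝 (L j)) := hX.tendsto_average_measureReal
  have hA0 : ∀ n j, 0 ≤ A n j := fun n j =>
    mul_nonneg (by positivity) (Finset.sum_nonneg fun _ _ => measureReal_nonneg)
  have hA1 : ∀ n j, A n j ≤ 1 := by
    intro n j
    have h1 : ∑ k ∈ Finset.Icc 1 n, μ.real {ω | X k ω = j} ≤ n := by
      simpa using Finset.sum_le_card_nsmul (Finset.Icc 1 n) (fun k => μ.real {ω | X k ω = j}) 1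
        fun _ _ => measureReal_le_one
    simp only [hA, one_div_mul_eq_div]
    exact div_le_one_of_le₀ h1 (by positivity)
  -- The limits `L j` inherit `0 ≤ L j ≤ 1` from the averages.
  have hLbound : ∀ j, ‖g j * L j‖ ≤ |g j| := by
    intro j
    rw [norm_mul, Real.norm_eq_abs, Real.norm_eq_abs, abs_of_nonneg
      (ge_of_tendsto' (hlim j) fun n => hA0 n j)]
    exact mul_le_of_le_one_right (abs_nonneg _) (le_of_tendsto' (hlim j) fun n => hA1 n j)
  have hsum : Summable fun j => g j * L j := Summable.of_norm_bounded hg hLbound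
  have hterm : ∀ j, g j / (meanReturnTime P j).toReal *
      ∑' i, μ.real {ω | X 0 ω = i} * hitProb P i j = g j * L j := fun j => by
    rw [hL, div_eq_mul_inv, mul_assoc]
  refine ⟨hint, hX.summable_mul_hitProb, ?_, ?_⟩
  · simp only [hterm]
    exact hsum.subtype _
  · simp only [hterm]
    -- Off the positive recurrent states `m j = ∞`; the conventions `toReal ∞ = 0` and `0⁻¹ = 0`
    -- give the correct limit `0`, so the sum over all states reduces to these states.
    have hsupp : Function.support (fun j => g j * L j) ⊆ {j | IsPositiveRecurrent P j} := by
      intro j hj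
      refine isPositiveRecurrent_iff.2 fun htop => hj ?_
      simp [hL, htop]
    have hsub : ∑' j : {j : S // IsPositiveRecurrent P j}, g j * L j = ∑' j, g j * L j :=
      tsum_subtype_eq_of_support_subset hsupp
    rw [hsub]
    have hk : ∀ k, HasSum (fun j => g j * μ.real {ω | X k ω = j}) (∫ ω, g (X k ω) ∂μ) := by
      intro k
      have hmap : Integrable g (μ.map (X k)) :=
        (integrable_map_measure hgm.aestronglyMeasurable (hX.measurable k).aemeasurable).2 (hint k)
      have h1 : ∫ ω, g (X k ω) ∂μ = ∑' j, g j * μ.real {ω | X k ω = j} := by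
        rw [← integral_map (hX.measurable k).aemeasurable hgm.aestronglyMeasurable,
          integral_countable hmap]
        refine tsum_congr fun j => ?_
        rw [map_measureReal_apply (hX.measurable k) (measurableSet_singleton j), smul_eq_mul,
          mul_comm]
        rfl
      rw [h1]
      refine (Summable.of_norm_bounded hg fun j => ?_).hasSum
      rw [norm_mul, Real.norm_eq_abs, Real.norm_eq_abs, abs_of_nonneg measureReal_nonneg]
      exact mul_le_of_le_one_right (abs_nonneg _) measureReal_le_one
    have hn : ∀ n : ℕ, (1 / (n : ℝ)) * ∑ k ∈ Finset.Icc 1 n, ∫ ω, g (X k ω) ∂μ =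
        ∑' j, g j * A n j := by
      intro n
      rw [← ((hasSum_sum fun k _ => hk k).mul_left (1 / (n : ℝ))).tsum_eq]
      refine tsum_congr fun j => ?_
      rw [hA, ← Finset.mul_sum, mul_left_comm]
    simp_rw [hn]
    refine tendsto_tsum_of_dominated_convergence hg (fun j => (hlim j).const_mul _)
      (Eventually.of_forall fun n j => ?_)
    rw [norm_mul, Real.norm_eq_abs, Real.norm_eq_abs, abs_of_nonneg (hA0 n j)]
    exact mul_le_of_le_one_right (abs_nonneg _) (hA1 n j)
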